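/- Let $\mathbf k$ be a commutative unitary ring of characteristic zero, $\lambda\in\mathbf k$, and $(X,\le)$ a well-ordered set. Let $\mathfrak S(X)$ be the set of nonunitary bracketed words on $X$: the nonempty finite products of primes, where a prime is a letter $x\in X$ or a bracket $\lfloor u\rfloor$ with $u\in\mathfrak S(X)$; a product of $n$ primes has breadth $n$. It is a semigroup under concatenation, and $\mathbf k\mathfrak S(X)$ is its semigroup algebra, with the linear operator extending $u\mapsto\lfloor u\rfloor$. Let $\mathfrak S^\star(X)$ be the set of bracketed words on $X\sqcup\{\star\}$ with exactly one occurrence of $\star$; $q|_u$ is the word obtained from $q$ by replacing $\star$ by $u$, extended linearly to $q|_s$ for $s\in\mathbf k\mathfrak S(X)$. Order the alphabet $X\sqcup\{P,\mu\}$ by extending $\le$ with $x<P<\mu$ for all $x\in X$, and order the words on it degree-lexicographically. For $w\in\mathfrak S(X)$ let $\deg(w)$ be the number of occurrences of letters in $w$, and let $\mathrm{path}_l(w)$ be the tuple, from left to right, of the paths of these letters, where: the path of $x$ in $x$ is $x$; the paths in $\lfloor u\rfloor$ are those in $u$ with $P$ prefixed; the paths in a product $w_1\cdots w_n$ of $n\ge2$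 primes are those in the $w_i$ with one $\mu$ prefixed. Compare words by $u\le_{\mathrm{PL}_l}v$ if and only if $(\deg(u),\mathrm{path}_l(u))\le(\deg(v),\mathrm{path}_l(v))$ lexicographically, and write $u<v$ for its strict part ($u\le_{\mathrm{PL}_l}v$ but not $v\le_{\mathrm{PL}_l}u$). A leading monomial of $f$ is a monomial $\bar f$ occurring in $f$ such that $m<\bar f$ for every other monomial $m$ occurring in $f$; $f$ is monic if it has a leading monomial and the coefficient of it is $1$. A set $S\subseteq\mathbf k\mathfrak S(X)$ is a Gröbner–Shirshov basis (with respect to this comparison) if all its elements are monic and, for all $f,g\in S$: (a) whenever $w=\bar fu=v\bar g$ with $u,v\in\mathfrak S(X)$ and $\max\{|\bar f|,|\bar g|\}<|w|<|\bar f|+|\bar g|$ (breadths), the element $fu-vg$ is trivial modulo $(S,w)$; (b) whenever $w=\bar f=q|_{\bar g}$ with $q\in\mathfrak S^\star(X)$, the element $f-q|_g$ is trivial modulo $(S,w)$. Here $h$ is trivial modulo $(S,w)$ if $h=\sum_i c_i\,q_i|_{s_i}$ (a finite sum) with $c_i\in\mathbf k$, $q_i\in\mathfrak S^\star(X)$,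 $s_i\in S$, where each $q_i|_{s_i}$ has a leading monomial and it is $<w$. Put $$f(x,y)=\lfloor\lfloor x\rfloor y\rfloor+\lfloor x\lfloor y\rfloor\rfloor+\lambda\lfloor xy\rfloor-\lfloor x\rfloor\lfloor y\rfloor,\qquad S=\{f(x,y)\mid x,y\in\mathfrak S(X)\}.$$ Then: 1. The strict part $<$ of $\le_{\mathrm{PL}_l}$ is a well-founded strict weak order on $\mathfrak S(X)$; $f(x,y)$ has leading monomial $\lfloor\lfloor x\rfloor y\rfloor$ for all $x,y\in\mathfrak S(X)$, and more generally $q|_{f(x,y)}$ has leading monomial $q|_{\lfloor\lfloor x\rfloor y\rfloor}$ for every $q\in\mathfrak S^\star(X)$; and $S$ is a Gröbner–Shirshov basis in $\mathbf k\mathfrak S(X)$. 2. Let $\mathrm{Id}(S)$ be the operated ideal generated by $S$, i.e. the smallest $\mathbf k$-submodule that is a two-sided ideal, is stable under the operator and contains $S$. The quotient $\mathbf k\mathfrak S(X)/\mathrm{Id}(S)$, with the induced product and operator and the images of the elements of $X$, is the free nonunitary Rota–Baxter algebra of weight $\lambda$ on $X$, that is, it is free among the nonunitary associative $\mathbf k$-algebras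 with a linear operator $P$ such that $P(a)P(b)=P(P(a)b)+P(aP(b))+\lambda P(ab)$. The images of the words in $$\mathrm{Irr}(S)=\mathfrak S(X)\setminus\{q|_{\lfloor\lfloor x\rfloor y\rfloor}\mid x,y\in\mathfrak S(X),\ q\in\mathfrak S^\star(X)\}$$ are pairwise distinct and form a $\mathbf k$-basis of it. -/

import Mathlib

universe u v w u'

/-! ### Nonunitary bracketed words -/

/-- Nonunitary bracketed words on `X`: nonempty finite products of primes, a prime being either a
letter `x` or a bracket `⌊u⌋` of a nonunitary bracketed word `u`.  The four constructors are
`x`, `⌊u⌋`, `x * w` and `⌊u⌋ * w`; so a word is given by its (unique) nonempty list of primes. -/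
inductive BrWord (X : Type u) : Type u
  | of (x : X) : BrWord X
  | br (u : BrWord X) : BrWord X
  | ofCons (x : X) (w : BrWord X) : BrWord X
  | brCons (u : BrWord X) (w : BrWord X) : BrWord X

namespace BrWord

variable {X : Type u}

/-- Concatenation of bracketed words. -/
def mul : BrWord X → BrWord X → BrWord X
  | of x, v => ofCons x v
  | br u, v => brCons u v
  | ofCons x w, v => ofCons x (mul w v)
  | brCons u w, v => brCons u (mul w v)

theorem mul_assoc' (a b c : BrWord X) : mul (mul a b) c = mul a (mul b c) := by
  induction a with
  | of x => rfl
  | br u => rfl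
  | ofCons x w ih => simp only [mul, ih]
  | brCons u w _ ih => simp only [mul, ih]

instance : Semigroup (BrWord X) where
  mul := mul
  mul_assoc := mul_assoc'

/-- The breadth `|w|`: the number of primes of which `w` is the product. -/
def breadth : BrWord X → ℕ
  | of _ => 1
  | br _ => 1
  | ofCons _ w => breadth w + 1
  | brCons _ w => breadth w + 1

/-- The total number of occurrences of letters in `w`. -/
def deg : BrWord X → ℕ
  | of _ => 1
  | br u => deg u
  | ofCons _ w => 1 + deg w
  | brCons u w => deg u + deg w

/-! ### Words with one hole -/

/-- The number of occurrences of the symbol `⋆`, which is the letter `none` of `Option X`. -/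
def starCount : BrWord (Option X) → ℕ
  | of none => 1
  | of (some _) => 0
  | br u => starCount u
  | ofCons none w => 1 + starCount w
  | ofCons (some _) w => starCount w
  | brCons u w => starCount u + starCount w

/-- Replace the symbol `⋆` by the word `u`. -/
def substStar (u : BrWord X) : BrWord (Option X) → BrWord X
  | of none => u
  | of (some x) => of x
  | br p => br (substStar u p)
  | ofCons none p => u * substStar u p
  | ofCons (some x) p => of x * substStar u p
  | brCons p r => br (substStar u p) * substStar u r

end BrWord

/-- `⋆`-bracketed words: the bracketed words on `X ⊔ {⋆}` with exactly one occurrence of `⋆`. -/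
def StarWord (X : Type u) : Type u := {q : BrWord (Option X) // q.starCount = 1}

/-- The word `q|_u`. -/
def StarWord.subst {X : Type u} (q : StarWord X) (a : BrWord X) : BrWord X :=
  BrWord.substStar a q.1

/-! ### The path order -/

/-- The alphabet `X ⊔ {P, μ}`, ordered by the order of `X` and `x < P < μ` for all `x`. -/
abbrev PathLetter (X : Type u) : Type u := WithTop (WithTop X)

namespace PathLetter

/-- A letter of `X`. -/
def letter {X : Type u} (x : X) : PathLetter X := ((x : WithTop X) : WithTop (WithTop X))

/-- The symbol `P`, which stands for the bracket. -/
def P {X : Type u} : PathLetter X := ((⊤ : WithTop X) : WithTop (WithTop X))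

/-- The symbol `μ`, which stands for the multiplication. -/
def mu {X : Type u} : PathLetter X := ⊤

end PathLetter

namespace BrWord

variable {X : Type u}

/-- The tuple of the paths of all letters of a word, from left to right.  In `⌊u⌋` every path
of `u` gets the prefix `P`; in a product of at least two primes every path of each prime gets the
prefix `μ`, exactly once (so if the cofactor `w` of the first prime is itself such a product, then
its paths in `w` already carry this `μ`). -/
def paths : BrWord X → List (List (PathLetter X))
  | of x => [[PathLetter.letter x]]
  | br u => (paths u).map (PathLetter.P :: ·)
  | ofCons x w =>
      [PathLetter.mu, PathLetter.letter x] ::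
        (if breadth w = 1 then (paths w).map (PathLetter.mu :: ·) else paths w)
  | brCons u w =>
      (paths u).map (fun p => PathLetter.mu :: PathLetter.P :: p) ++
        (if breadth w = 1 then (paths w).map (PathLetter.mu :: ·) else paths w)

/-- The strict comparison `a < b` of words: the pairs (degree, tuple of paths) are compared
lexicographically, tuples of paths being compared lexicographically and single paths by the degree
lexicographical order (first the length, then lexicographically) on words in `X ⊔ {P, μ}`. -/
def PathLT [LinearOrder X] (a b : BrWord X) : Prop :=
  a.deg < b.deg ∨
    a.deg = b.deg ∧ List.Lex (List.Shortlex (· < ·)) a.paths b.paths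

end BrWord

/-! ### The operated algebra of bracketed words -/

/-- The free module on the bracketed words with the multiplication that extends concatenation. -/
abbrev BrAlg (k : Type u) (X : Type v) [CommRing k] : Type (max u v) :=
  MonoidAlgebra k (BrWord X)

namespace BrAlg

variable (k : Type u) {X : Type v} [CommRing k]

/-- A bracketed word as an element of the algebra. -/
noncomputable def word (a : BrWord X) : BrAlg k X := MonoidAlgebra.single a 1

variable {k}

/-- The linear operator that extends `u ↦ ⌊u⌋`. -/
noncomputable def bracket : BrAlg k X →ₗ[k] BrAlg k X where
  toFun := MonoidAlgebra.mapDomain BrWord.br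
  map_add' := MonoidAlgebra.mapDomain_add _
  map_smul' := fun c f => MonoidAlgebra.mapDomain_smul _ c f

/-- The element `q|_s`, obtained from `s = ∑ cᵢ uᵢ` as `∑ cᵢ q|_{uᵢ}`. -/
noncomputable def subst (q : StarWord X) (s : BrAlg k X) : BrAlg k X :=
  MonoidAlgebra.mapDomain q.subst s

/-! ### Gröbner–Shirshov bases with respect to a comparison `lt` of words -/

/-- `m` is the leading monomial of `f`: it occurs in `f`, and every other monomial that occurs in
`f` is strictly smaller. -/
def IsLeading (lt : BrWord X → BrWord X → Prop) (f : BrAlg k X) (m : BrWord X) : Prop :=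
  f.coeff m ≠ 0 ∧ ∀ m', f.coeff m' ≠ 0 → m' ≠ m → lt m' m

/-- `f` is monic: it has a leading monomial, with coefficient `1`. -/
def IsMonic (lt : BrWord X → BrWord X → Prop) (f : BrAlg k X) : Prop :=
  ∃ m, IsLeading lt f m ∧ f.coeff m = 1

/-- `f` is trivial modulo `(S, w)`: it is a finite sum `∑ cᵢ qᵢ|_{sᵢ}` with `sᵢ ∈ S` and the leading
monomial of every `qᵢ|_{sᵢ}` smaller than `w`. -/
def IsTrivialMod (lt : BrWord X → BrWord X → Prop) (S : Set (BrAlg k X)) (w : BrWord X)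
    (f : BrAlg k X) : Prop :=
  f ∈ Submodule.span k
    {h : BrAlg k X | ∃ q : StarWord X, ∃ s ∈ S, h = subst q s ∧ ∃ m, IsLeading lt h m ∧ lt m w}

/-- `S` is monic and all its intersection and including compositions are trivial. -/
structure IsGroebnerShirshovBasis (lt : BrWord X → BrWord X → Prop) (S : Set (BrAlg k X)) :
    Prop where
  monic : ∀ s ∈ S, IsMonic lt s
  intersection : ∀ f ∈ S, ∀ g ∈ S, ∀ mf mg : BrWord X, IsLeading lt f mf → IsLeading lt g mg →
    ∀ a b w : BrWord X, w = mf * a → w = b * mg →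
      max mf.breadth mg.breadth < w.breadth → w.breadth < mf.breadth + mg.breadth →
        IsTrivialMod lt S w (f * word k a - word k b * g)
  including : ∀ f ∈ S, ∀ g ∈ S, ∀ mf mg : BrWord X, IsLeading lt f mf → IsLeading lt g mg →
    ∀ (w : BrWord X) (q : StarWord X), w = mf → w = q.subst mg →
      IsTrivialMod lt S w (f - subst q g)

end BrAlg

/-! ### Operated ideals and quotients -/

section Operated

variable {k : Type u} {A : Type v} [CommRing k] [NonUnitalRing A] [Module k A]

/-- An operated ideal of a nonunitary algebra `A` with a linear operator `P`: a two-sided ideal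
(and submodule) that is stable under `P`. -/
structure OperatedIdeal (P : A →ₗ[k] A) extends Submodule k A where
  mul_left_mem' : ∀ (a : A) {x : A}, x ∈ carrier → a * x ∈ carrier
  mul_right_mem' : ∀ (a : A) {x : A}, x ∈ carrier → x * a ∈ carrier
  map_mem' : ∀ {x : A}, x ∈ carrier → P x ∈ carrier

namespace OperatedIdeal

/-- The operated ideal generated by a set: the smallest one that contains it. -/
def generate (P : A →ₗ[k] A) (S : Set A) : OperatedIdeal P where
  carrier := {x | ∀ I : OperatedIdeal P, S ⊆ (I.toSubmodule : Set A) → x ∈ I.toSubmodule}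
  zero_mem' := fun I _ => I.toSubmodule.zero_mem
  add_mem' := fun hx hy I hI => I.toSubmodule.add_mem (hx I hI) (hy I hI)
  smul_mem' := fun c _ hx I hI => I.toSubmodule.smul_mem c (hx I hI)
  mul_left_mem' := fun a _ hx I hI => I.mul_left_mem' a (hx I hI)
  mul_right_mem' := fun a _ hx I hI => I.mul_right_mem' a (hx I hI)
  map_mem' := fun hx I hI => I.map_mem' (hx I hI)

variable {P : A →ₗ[k] A}

/-- The quotient by an operated ideal. -/
def Quotient (I : OperatedIdeal P) : Type v := A ⧸ I.toSubmodule

namespace Quotient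

variable (I : OperatedIdeal P)

instance : AddCommGroup I.Quotient := inferInstanceAs (AddCommGroup (A ⧸ I.toSubmodule))

instance : Module k I.Quotient := inferInstanceAs (Module k (A ⧸ I.toSubmodule))

/-- The canonical map `η` to the quotient. -/
def mk : A →ₗ[k] I.Quotient := I.toSubmodule.mkQ

theorem mk_surjective : Function.Surjective (mk I) := I.toSubmodule.mkQ_surjective

theorem mk_eq_iff {x y : A} : mk I x = mk I y ↔ x - y ∈ I.toSubmodule :=
  Submodule.Quotient.eq I.toSubmodule

theorem mul_congr {a a' b b' : A} (h : a - a' ∈ I.toSubmodule) (h' : b - b' ∈ I.toSubmodule) :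
    a * b - a' * b' ∈ I.toSubmodule := by
  have e : a * b - a' * b' = (a - a') * b + a' * (b - b') := by noncomm_ring
  rw [e]
  exact I.toSubmodule.add_mem (I.mul_right_mem' b h) (I.mul_left_mem' a' h')

/-- The product of the quotient, `η(a) η(b) = η(a b)`. -/
instance : Mul I.Quotient where
  mul := _root_.Quotient.map₂ (· * ·) (fun _ _ h _ _ h' =>
    I.toSubmodule.quotientRel_def.mpr
      (mul_congr I (I.toSubmodule.quotientRel_def.mp h) (I.toSubmodule.quotientRel_def.mp h')))

theorem mk_mul (a b : A) : mk I (a * b) = mk I a * mk I b := rfl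

instance : NonUnitalRing I.Quotient where
  __ := (inferInstance : AddCommGroup I.Quotient)
  __ := (inferInstance : Mul I.Quotient)
  left_distrib := by
    intro a b c
    obtain ⟨a, rfl⟩ := mk_surjective I a
    obtain ⟨b, rfl⟩ := mk_surjective I b
    obtain ⟨c, rfl⟩ := mk_surjective I c
    simp only [← map_add, ← mk_mul, mul_add]
  right_distrib := by
    intro a b c
    obtain ⟨a, rfl⟩ := mk_surjective I a
    obtain ⟨b, rfl⟩ := mk_surjective I b
    obtain ⟨c, rfl⟩ := mk_surjective I c
    simp only [← map_add, ← mk_mul, add_mul]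
  zero_mul := by
    intro a
    obtain ⟨a, rfl⟩ := mk_surjective I a
    rw [← map_zero (mk I), ← mk_mul, zero_mul]
  mul_zero := by
    intro a
    obtain ⟨a, rfl⟩ := mk_surjective I a
    rw [← map_zero (mk I), ← mk_mul, mul_zero]
  mul_assoc := by
    intro a b c
    obtain ⟨a, rfl⟩ := mk_surjective I a
    obtain ⟨b, rfl⟩ := mk_surjective I b
    obtain ⟨c, rfl⟩ := mk_surjective I c
    simp only [← mk_mul, mul_assoc]

instance [IsScalarTower k A A] : IsScalarTower k I.Quotient I.Quotient where
  smul_assoc := by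
    intro c a b
    obtain ⟨a, rfl⟩ := mk_surjective I a
    obtain ⟨b, rfl⟩ := mk_surjective I b
    simp only [smul_eq_mul, ← map_smul, ← mk_mul, smul_mul_assoc]

instance [SMulCommClass k A A] : SMulCommClass k I.Quotient I.Quotient where
  smul_comm := by
    intro c a b
    obtain ⟨a, rfl⟩ := mk_surjective I a
    obtain ⟨b, rfl⟩ := mk_surjective I b
    simp only [smul_eq_mul, ← map_smul, ← mk_mul, mul_smul_comm]

/-- The operator of the quotient, `η(a) ↦ η(P a)`. -/
def operator : I.Quotient →ₗ[k] I.Quotient :=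
  I.toSubmodule.mapQ I.toSubmodule P (fun _ hx => I.map_mem' hx)

theorem operator_mk (a : A) : operator I (mk I a) = mk I (P a) := rfl

end Quotient

end OperatedIdeal

end Operated

/-! ### Rota–Baxter algebras -/

section RotaBaxter

variable {k : Type u} [CommRing k]

/-- The Rota–Baxter identity of weight `lam`. -/
def IsRotaBaxter {A : Type v} [NonUnitalRing A] [Module k A] (lam : k) (P : A →ₗ[k] A) : Prop :=
  ∀ x y : A, P x * P y = P (P x * y) + P (x * P y) + lam • P (x * y)

/-- `(F, P)` with `i : X → F` is the free nonunitary Rota–Baxter algebra of weight `lam` on `X`: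
it is a Rota–Baxter algebra, and every map from `X` to a nonunitary Rota–Baxter algebra `(A, Q)` of
weight `lam` (with `A` in the universe `w`) extends uniquely to a homomorphism of Rota–Baxter
algebras. -/
def IsFreeRotaBaxter {X : Type u'} {F : Type v} [NonUnitalRing F] [Module k F]
    [IsScalarTower k F F] [SMulCommClass k F F] (lam : k) (P : F →ₗ[k] F) (i : X → F) : Prop :=
  IsRotaBaxter lam P ∧
    ∀ (A : Type w) [NonUnitalRing A] [Module k A] [IsScalarTower k A A] [SMulCommClass k A A]
      (Q : A →ₗ[k] A), IsRotaBaxter lam Q → ∀ g : X → A,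
        ∃! φ : F →ₙₐ[k] A, (∀ a, φ (P a) = Q (φ a)) ∧ ∀ x, φ (i x) = g x

variable {X : Type v}

/-- The element `⌊⌊x⌋y⌋ + ⌊x⌊y⌋⌋ + lam ⌊xy⌋ - ⌊x⌋⌊y⌋`. -/
noncomputable def rbElement (lam : k) (x y : BrWord X) : BrAlg k X :=
  BrAlg.word k (.br (.br x * y)) + BrAlg.word k (.br (x * .br y))
    + lam • BrAlg.word k (.br (x * y)) - BrAlg.word k (.br x * .br y)

/-- The set of all these elements. -/
def rbSet (X : Type v) (lam : k) : Set (BrAlg k X) :=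
  {f | ∃ x y : BrWord X, f = rbElement lam x y}

/-- The words that contain no subword of the form `⌊⌊x⌋y⌋`. -/
def rbIrr (X : Type v) : Set (BrWord X) :=
  {a | ¬ ∃ (q : StarWord X) (x y : BrWord X), a = q.subst (.br (.br x * y))}

/-- The operated ideal generated by the set `rbSet X lam`. -/
noncomputable def rbIdeal (X : Type v) (lam : k) :
    OperatedIdeal (BrAlg.bracket : BrAlg k X →ₗ[k] BrAlg k X) :=
  OperatedIdeal.generate BrAlg.bracket (rbSet X lam)

end RotaBaxter

/-! ### Degree, breadth and paths of products -/

namespace BrWord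

variable {X : Type u}

/-! A word has as many paths as letters, so the comparison is the pull-back, along `paths`, of an
iterated shortlex order; well-foundedness comes from there.

The comparison itself is not respected by contexts: as a factor of a product a prime gains a `μ` in
its paths, a longer product does not. The argument therefore runs through the stronger relation
`PathShorter`, where the larger word has the longer path at the first place of difference and at
most the same breadth. This relation is preserved by all contexts. It holds between each lower
monomial of `f(x,y)` and `⌊⌊x⌋y⌋`, since the path of the first letter of the latter has three
symbols `P μ P` in front of its path in `x`, and the others have at most two.

Leading monomials have breadth 1, so there are no intersection compositions. An including
composition places `⌊⌊x'⌋y'⌋` inside `⌊⌊x⌋y⌋`: as the whole word, as `⌊x⌋`, inside `x`, or inside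
`y`. Explicit identities resolve the nontrivial cases (`isTrivialMod_nested`, `isTrivialMod_left`,
`isTrivialMod_right`).

Irreducible words span the quotient by well-founded induction (`span_rbIrr`). Their independence is
proved without a composition-diamond lemma: the algebra of bracketed words itself, with
concatenation, carries a Rota–Baxter operator `rewriteOp` that brackets a word and rewrites at the
outermost level. The universal property then maps the quotient to this algebra, and each irreducible
word goes to itself. -/

theorem ofCons_eq (x : X) (a : BrWord X) : ofCons x a = of x * a := rfl

theorem brCons_eq (a b : BrWord X) : brCons a b = br a * b := rfl

@[simp]
theorem deg_mul (a b : BrWord X) : (a * b).deg = a.deg + b.deg := by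
  induction a with
  | of x => rfl
  | br u => rfl
  | ofCons x a ih =>
    change 1 + (a * b).deg = 1 + a.deg + b.deg
    rw [ih, add_assoc]
  | brCons c a _ ih =>
    change c.deg + (a * b).deg = c.deg + a.deg + b.deg
    rw [ih, add_assoc]

theorem deg_pos (a : BrWord X) : 0 < a.deg := by
  induction a <;> simp only [deg] <;> omega

@[simp]
theorem breadth_mul (a b : BrWord X) : (a * b).breadth = a.breadth + b.breadth := by
  induction a with
  | of x => exact add_comm _ _
  | br u => exact add_comm _ _
  | ofCons x a ih =>
    change (a * b).breadth + 1 = a.breadth + 1 + b.breadth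
    rw [ih]; omega
  | brCons c a _ ih =>
    change (a * b).breadth + 1 = a.breadth + 1 + b.breadth
    rw [ih]; omega

theorem breadth_pos (a : BrWord X) : 0 < a.breadth := by
  cases a <;> simp [breadth]

@[simp]
theorem length_paths (a : BrWord X) : a.paths.length = a.deg := by
  induction a with
  | of x => rfl
  | br u ih => simp [paths, deg, ih]
  | ofCons x a ih => simp only [paths, deg]; split_ifs <;> simp [ih, add_comm]
  | brCons c a ihc ih => simp only [paths, deg]; split_ifs <;> simp [ih, ihc]

/-- The paths of the letters of `a` as a factor of a product of at least two primes. -/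
def factorPaths (a : BrWord X) : List (List (PathLetter X)) :=
  if a.breadth = 1 then a.paths.map (PathLetter.mu :: ·) else a.paths

theorem factorPaths_of_ne {a : BrWord X} (h : a.breadth ≠ 1) : a.factorPaths = a.paths :=
  if_neg h

theorem paths_mul (a b : BrWord X) : (a * b).paths = a.factorPaths ++ b.factorPaths := by
  induction a with
  | of x => rfl
  | br u =>
    change u.paths.map _ ++ b.factorPaths = _
    simp [factorPaths, breadth, paths]
  | ofCons x a ih =>
    have h : (ofCons x a).breadth ≠ 1 := (Nat.succ_lt_succ a.breadth_pos).ne'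
    have h' : (a * b).breadth ≠ 1 := by
      have := a.breadth_pos
      have := b.breadth_pos
      rw [breadth_mul]; omega
    rw [factorPaths_of_ne h]
    change _ :: (a * b).factorPaths = (_ :: a.factorPaths) ++ _
    rw [factorPaths_of_ne h', ih, List.cons_append]
  | brCons c a _ ih =>
    have h : (brCons c a).breadth ≠ 1 := (Nat.succ_lt_succ a.breadth_pos).ne'
    have h' : (a * b).breadth ≠ 1 := by
      have := a.breadth_pos
      have := b.breadth_pos
      rw [breadth_mul]; omega
    rw [factorPaths_of_ne h]
    change _ ++ (a * b).factorPaths = (_ ++ a.factorPaths) ++ _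
    rw [factorPaths_of_ne h', ih, List.append_assoc]

/-! ### Well-foundedness of the path order -/

section Order

variable [LinearOrder X]

/-- The degree is the length of the path tuple, so degree first and then `List.Lex` is again a
shortlex order. -/
theorem pathLT_iff {a b : BrWord X} :
    PathLT a b ↔ List.Shortlex (List.Shortlex (· < ·)) a.paths b.paths := by
  simp [PathLT, List.shortlex_def]

theorem wellFounded_pathLT [WellFoundedLT X] :
    WellFounded (PathLT : BrWord X → BrWord X → Prop) := by
  have h := InvImage.wf (paths : BrWord X → _)
    (List.Shortlex.wf (List.Shortlex.wf (wellFounded_lt (α := PathLetter X))))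
  convert h using 1
  ext a b
  exact pathLT_iff

/-- Incomparable words are those with equal path tuples. They need not be equal: in both `⌊ab⌋⌊cde⌋`
and `⌊abc⌋⌊de⌋` every letter has the prefix `μ P μ`. -/
instance isStrictWeakOrder_pathLT [WellFoundedLT X] :
    IsStrictWeakOrder (BrWord X) PathLT := by
  let s : List (List (PathLetter X)) → List (List (PathLetter X)) → Prop :=
    List.Shortlex (List.Shortlex (· < ·))
  have wf : WellFounded s :=
    List.Shortlex.wf (List.Shortlex.wf (wellFounded_lt (α := PathLetter X)))
  have : IsWellFounded _ s := ⟨wf⟩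
  have : IsWellOrder _ s := {}
  refine { irrefl := fun a h => ?_, trans := fun a b c h h' => ?_, incomp_trans := ?_ }
  · exact irrefl_of s _ (pathLT_iff.mp h)
  · exact pathLT_iff.mpr (trans_of s (pathLT_iff.mp h) (pathLT_iff.mp h'))
  · simp only [pathLT_iff]
    intro a b c h h'
    have e : ∀ l l' : List (List (PathLetter X)), ¬ s l l' ∧ ¬ s l' l → l = l' := fun l l' hl => by
      rcases trichotomous_of s l l' with h | h | h
      exacts [absurd h hl.1, h, absurd h hl.2]
    rw [e _ _ h, e _ _ h']
    exact ⟨irrefl_of s _, irrefl_of s _⟩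

theorem not_pathLT_self [WellFoundedLT X] (a : BrWord X) : ¬ PathLT a a :=
  irrefl_of PathLT a

end Order

/-! ### A stronger comparison, compatible with contexts -/

/-- The path tuples of `a` and `b` have a common initial segment after which `b` has the longer
path, while `b` is the product of at most as many primes as `a`. -/
structure PathShorter (a b : BrWord X) : Prop where
  deg_eq : a.deg = b.deg
  breadth_le : b.breadth ≤ a.breadth
  paths_eq : ∃ l p r p' r', a.paths = l ++ p :: r ∧ b.paths = l ++ p' :: r' ∧ p.length < p'.length

namespace PathShorter

theorem pathLT [LinearOrder X] {a b : BrWord X} (h : PathShorter a b) : PathLT a b := by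
  obtain ⟨l, p, r, p', r', ha, hb, hp⟩ := h.paths_eq
  refine Or.inr ⟨h.deg_eq, ?_⟩
  rw [ha, hb]
  exact List.Lex.append_left _ (List.Lex.rel (List.Shortlex.of_length_lt hp)) l

theorem br {a b : BrWord X} (h : PathShorter a b) : PathShorter (.br a) (.br b) := by
  obtain ⟨l, p, r, p', r', ha, hb, hp⟩ := h.paths_eq
  refine ⟨h.deg_eq, le_rfl, l.map (PathLetter.P :: ·), PathLetter.P :: p,
    r.map (PathLetter.P :: ·), PathLetter.P :: p', r'.map (PathLetter.P :: ·), ?_, ?_, ?_⟩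
  · simp [paths, ha]
  · simp [paths, hb]
  · simpa using hp

/-- The breadth condition is what makes this work: if the paths of `a` gain a `μ`, then `a` is
prime, hence so is `b`, and its paths gain one too. -/
theorem factorPaths_eq {a b : BrWord X} (h : PathShorter a b) :
    ∃ l p r p' r', a.factorPaths = l ++ p :: r ∧ b.factorPaths = l ++ p' :: r' ∧
      p.length < p'.length := by
  obtain ⟨l, p, r, p', r', ha, hb, hp⟩ := h.paths_eq
  by_cases h₁ : a.breadth = 1
  · have h₂ : b.breadth = 1 := le_antisymm (h.breadth_le.trans h₁.le) b.breadth_pos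
    refine ⟨l.map (PathLetter.mu :: ·), PathLetter.mu :: p, r.map (PathLetter.mu :: ·),
      PathLetter.mu :: p', r'.map (PathLetter.mu :: ·), ?_, ?_, ?_⟩
    · simp [factorPaths, h₁, ha]
    · simp [factorPaths, h₂, hb]
    · simpa using hp
  · rw [factorPaths_of_ne h₁]
    by_cases h₂ : b.breadth = 1
    · have hb' : b.factorPaths = b.paths.map (PathLetter.mu :: ·) := if_pos h₂
      -- Only the paths of `b` gain a `μ`, so the first paths already differ in length, even if they
      -- belonged to the common initial segment.
      cases l with
      | nil =>
        refine ⟨[], p, r, PathLetter.mu :: p', r'.map (PathLetter.mu :: ·), ha, ?_, ?_⟩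
        · simp [hb', hb]
        · simp only [List.length_cons]; omega
      | cons p₀ l =>
        refine ⟨[], p₀, l ++ p :: r, PathLetter.mu :: p₀,
          (l ++ p' :: r').map (PathLetter.mu :: ·), ha, ?_, ?_⟩
        · simp [hb', hb]
        · simp
    · rw [factorPaths_of_ne h₂]
      exact h.paths_eq

theorem mul_left {a b : BrWord X} (h : PathShorter a b) (c : BrWord X) :
    PathShorter (c * a) (c * b) := by
  obtain ⟨l, p, r, p', r', ha, hb, hp⟩ := h.factorPaths_eq
  refine ⟨by simp [h.deg_eq], by simpa using h.breadth_le, c.factorPaths ++ l, p, r, p', r', ?_, ?_,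
    hp⟩
  · simp [paths_mul, ha]
  · simp [paths_mul, hb]

theorem mul_right {a b : BrWord X} (h : PathShorter a b) (c : BrWord X) :
    PathShorter (a * c) (b * c) := by
  obtain ⟨l, p, r, p', r', ha, hb, hp⟩ := h.factorPaths_eq
  refine ⟨by simp [h.deg_eq], by simpa using h.breadth_le, l, p, r ++ c.factorPaths, p',
    r' ++ c.factorPaths, ?_, ?_, hp⟩
  · simp [paths_mul, ha]
  · simp [paths_mul, hb]

end PathShorter

/-- The length of the path of the first letter. -/
def firstLen (a : BrWord X) : ℕ := a.paths.headI.length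

theorem exists_paths_eq_cons (a : BrWord X) : ∃ p r, a.paths = p :: r := by
  apply List.exists_cons_of_length_pos
  rw [length_paths]
  exact a.deg_pos

@[simp]
theorem firstLen_br (a : BrWord X) : (br a).firstLen = a.firstLen + 1 := by
  obtain ⟨p, r, h⟩ := a.exists_paths_eq_cons
  simp [firstLen, paths, h]

@[simp]
theorem firstLen_mul (a b : BrWord X) :
    (a * b).firstLen = a.firstLen + if a.breadth = 1 then 1 else 0 := by
  obtain ⟨p, r, h⟩ := a.exists_paths_eq_cons
  unfold firstLen
  rw [paths_mul, factorPaths]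
  split_ifs <;> simp [h]

theorem PathShorter.of_firstLen_lt {a b : BrWord X} (hd : a.deg = b.deg)
    (hb : b.breadth ≤ a.breadth) (hl : a.firstLen < b.firstLen) : PathShorter a b := by
  obtain ⟨p, r, h⟩ := a.exists_paths_eq_cons
  obtain ⟨p', r', h'⟩ := b.exists_paths_eq_cons
  refine ⟨hd, hb, [], p, r, p', r', h, h', ?_⟩
  simpa [firstLen, h, h'] using hl

@[simp]
theorem deg_br (a : BrWord X) : (br a).deg = a.deg := rfl

@[simp]
theorem breadth_br (a : BrWord X) : (br a).breadth = 1 := rfl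

/-- In `⌊x⌊y⌋⌋` the first path has the prefix `P`, or `P μ` if `x` is prime, against `P μ P` in
`⌊⌊x⌋y⌋`. -/
theorem pathShorter_br_mul_br (x y : BrWord X) :
    PathShorter (br (x * br y)) (br (br x * y)) := by
  apply PathShorter.of_firstLen_lt
  · simp
  · simp
  · simp only [firstLen_br, firstLen_mul, breadth_br]; split_ifs <;> omega

theorem pathShorter_br_mul (x y : BrWord X) : PathShorter (br (x * y)) (br (br x * y)) := by
  apply PathShorter.of_firstLen_lt
  · simp
  · simp
  · simp only [firstLen_br, firstLen_mul, breadth_br]; split_ifs <;> omega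

theorem pathShorter_mul_br (x y : BrWord X) : PathShorter (br x * br y) (br (br x * y)) := by
  apply PathShorter.of_firstLen_lt
  · simp
  · simp
  · simp

/-! ### Contexts -/

/-- The maps `u ↦ q|_u` for words `q` with one hole, described without the hole. -/
inductive IsContext : (BrWord X → BrWord X) → Prop
  | id : IsContext fun a => a
  | br {c} : IsContext c → IsContext fun a => br (c a)
  | mulLeft {c} (b : BrWord X) : IsContext c → IsContext fun a => b * c a
  | mulRight {c} (b : BrWord X) : IsContext c → IsContext fun a => c a * b

theorem IsContext.pathShorter {c : BrWord X → BrWord X} (hc : IsContext c) {a b : BrWord X}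
    (h : PathShorter a b) : PathShorter (c a) (c b) := by
  induction hc with
  | id => exact h
  | br _ ih => exact ih.br
  | mulLeft b _ ih => exact ih.mul_left b
  | mulRight b _ ih => exact ih.mul_right b

theorem substStar_eq_of_starCount_eq_zero (p : BrWord (Option X)) (h : p.starCount = 0)
    (a b : BrWord X) : substStar a p = substStar b p := by
  induction p with
  | of x => cases x with
    | none => simp [starCount] at h
    | some x => rfl
  | br p ih => simp only [substStar, ih h]
  | ofCons x p ih => cases x with
    | none => simp [starCount] at h
    | some x => simp only [substStar, ih h]
  | brCons p r ihp ihr =>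
    simp only [starCount, Nat.add_eq_zero_iff] at h
    simp only [substStar, ihp h.1, ihr h.2]

/-- In a product the only hole lies in one factor, and the substituted value of the other factor is
a constant word. -/
theorem isContext_substStar (p : BrWord (Option X)) (h : p.starCount = 1) :
    IsContext fun a => substStar a p := by
  induction p with
  | of x => cases x with
    | none => exact .id
    | some x => simp [starCount] at h
  | br p ih => exact (ih h).br
  | ofCons x p ih => cases x with
    | none =>
      have h0 : p.starCount = 0 := by simpa [starCount] using h
      -- Some word `b` is needed to name the constant cofactor. For empty `X` there is none, but
      -- then all maps of words coincide.
      rcases isEmpty_or_nonempty (BrWord X) with hX | ⟨⟨b⟩⟩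
      · rw [Subsingleton.elim (fun a : BrWord X => _) fun a => a]
        exact .id
      · have e : (fun a : BrWord X => substStar a (ofCons none p)) =
            fun a => a * substStar b p :=
          funext fun a => congrArg (a * ·) (substStar_eq_of_starCount_eq_zero p h0 _ _)
        rw [e]
        exact IsContext.id.mulRight _
    | some x => exact (ih h).mulLeft (of x)
  | brCons p r ihp ihr =>
    rcases isEmpty_or_nonempty (BrWord X) with hX | ⟨⟨b⟩⟩
    · rw [Subsingleton.elim (fun a : BrWord X => _) fun a => a]
      exact .id
    have h' : p.starCount + r.starCount = 1 := h
    rcases Nat.add_eq_one_iff.mp h' with ⟨hp, hr⟩ | ⟨hp, hr⟩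
    · have e : (fun a : BrWord X => substStar a (brCons p r)) =
          fun a => br (substStar b p) * substStar a r :=
        funext fun a => congrArg (br · * substStar a r)
          (substStar_eq_of_starCount_eq_zero p hp _ _)
      rw [e]
      exact (ihr hr).mulLeft _
    · have e : (fun a : BrWord X => substStar a (brCons p r)) =
          fun a => br (substStar a p) * substStar b r :=
        funext fun a => congrArg (br (substStar a p) * ·)
          (substStar_eq_of_starCount_eq_zero r hr _ _)
      rw [e]
      exact (ihp hp).br.mulRight _

theorem isContext_subst (q : StarWord X) : IsContext q.subst := isContext_substStar q.1 q.2

/-- A word, considered as a word with no hole. -/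
def toOption : BrWord X → BrWord (Option X)
  | of x => of (some x)
  | br u => br (toOption u)
  | ofCons x w => ofCons (some x) (toOption w)
  | brCons u w => brCons (toOption u) (toOption w)

@[simp]
theorem starCount_toOption (a : BrWord X) : a.toOption.starCount = 0 := by
  induction a <;> simp_all [toOption, starCount]

@[simp]
theorem substStar_toOption (a b : BrWord X) : substStar b a.toOption = a := by
  induction a <;> simp_all [toOption, substStar] <;> rfl

@[simp]
theorem starCount_mul (p r : BrWord (Option X)) :
    (p * r).starCount = p.starCount + r.starCount := by
  induction p with
  | of x => cases x <;> simp [← ofCons_eq, starCount]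
  | br p => rfl
  | ofCons x p ih =>
    cases x with
    | none =>
      change 1 + (p * r).starCount = 1 + p.starCount + r.starCount
      rw [ih, add_assoc]
    | some x => exact ih
  | brCons p r' _ ih =>
    change p.starCount + (r' * r).starCount = p.starCount + r'.starCount + r.starCount
    rw [ih, add_assoc]

@[simp]
theorem substStar_mul (a : BrWord X) (p r : BrWord (Option X)) :
    substStar a (p * r) = substStar a p * substStar a r := by
  induction p with
  | of x => cases x <;> rfl
  | br p => rfl
  | ofCons x p ih =>
    cases x with
    | none =>
      change a * substStar a (p * r) = a * substStar a p * _
      rw [ih, mul_assoc]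
    | some x =>
      change of x * substStar a (p * r) = of x * substStar a p * _
      rw [ih, mul_assoc]
  | brCons p r' _ ih =>
    change br (substStar a p) * substStar a (r' * r) = br (substStar a p) * substStar a r' * _
    rw [ih, mul_assoc]

theorem IsContext.exists_subst_eq {c : BrWord X → BrWord X} (hc : IsContext c) :
    ∃ q : StarWord X, q.subst = c := by
  induction hc with
  | id => exact ⟨⟨of none, rfl⟩, rfl⟩
  | br _ ih =>
    obtain ⟨q, rfl⟩ := ih
    exact ⟨⟨BrWord.br q.1, q.2⟩, rfl⟩
  | mulLeft b _ ih =>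
    obtain ⟨q, rfl⟩ := ih
    exact ⟨⟨b.toOption * q.1, by simp [q.2]⟩, by ext1 a; simp [StarWord.subst]⟩
  | mulRight b _ ih =>
    obtain ⟨q, rfl⟩ := ih
    exact ⟨⟨q.1 * b.toOption, by simp [q.2]⟩, by ext1 a; simp [StarWord.subst]⟩

/-- Unique factorization into primes: `⌊x⌋` is the first prime of `a`, and `d` collects its
remaining primes, if any. -/
theorem eq_and_eq_or_of_mul_eq_br_mul {a b x y : BrWord X} (h : a * b = br x * y) :
    a = br x ∧ b = y ∨ ∃ d, a = br x * d ∧ d * b = y := by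
  cases a with
  | of z => exact absurd h (by rintro ⟨⟩)
  | br u =>
    change brCons u b = brCons x y at h
    obtain ⟨rfl, rfl⟩ := brCons.inj h
    exact .inl ⟨rfl, rfl⟩
  | ofCons z w => exact absurd h (by rintro ⟨⟩)
  | brCons u w =>
    change brCons u (w * b) = brCons x y at h
    obtain ⟨rfl, rfl⟩ := brCons.inj h
    exact .inr ⟨w, rfl, rfl⟩

theorem mul_ne_br (a b x : BrWord X) : a * b ≠ br x := fun h => by
  have := congrArg breadth h
  have := a.breadth_pos
  have := b.breadth_pos
  simp only [breadth_mul, breadth_br] at *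
  omega

/-- The hole of a context that yields a bracket either is the whole word or lies inside the
bracket. -/
theorem IsContext.eq_id_or_of_apply_eq_br {c : BrWord X → BrWord X} (hc : IsContext c)
    {a x : BrWord X} (h : c a = BrWord.br x) :
    c = (fun t => t) ∨ ∃ d, IsContext d ∧ d a = x ∧ c = fun t => BrWord.br (d t) := by
  cases hc with
  | id => exact .inl rfl
  | @br d hd => exact .inr ⟨d, hd, br.inj h, rfl⟩
  | mulLeft b _ => exact absurd h (mul_ne_br _ _ _)
  | mulRight b _ => exact absurd h (mul_ne_br _ _ _)

/-- The hole of a context that yields a product `⌊x⌋ y`, when filled by a bracket, lies in one of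
the two factors. -/
theorem IsContext.of_apply_eq_br_mul {c : BrWord X → BrWord X} (hc : IsContext c)
    {a x y : BrWord X} (h : c (BrWord.br a) = BrWord.br x * y) :
    (∃ d, IsContext d ∧ d (BrWord.br a) = BrWord.br x ∧ c = fun t => d t * y) ∨
      ∃ d, IsContext d ∧ d (BrWord.br a) = y ∧ c = fun t => BrWord.br x * d t := by
  induction hc generalizing y with
  | id => exact absurd h.symm (mul_ne_br _ _ _)
  | br _ _ => exact absurd h.symm (mul_ne_br _ _ _)
  | @mulLeft d b hd _ =>
    rcases eq_and_eq_or_of_mul_eq_br_mul h with ⟨rfl, h'⟩ | ⟨e, rfl, h'⟩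
    · exact .inr ⟨d, hd, h', rfl⟩
    · exact .inr ⟨_, hd.mulLeft e, h', by simp only [mul_assoc]⟩
  | @mulRight d b hd ih =>
    rcases eq_and_eq_or_of_mul_eq_br_mul h with ⟨h', rfl⟩ | ⟨e, h', rfl⟩
    · exact .inl ⟨d, hd, h', rfl⟩
    -- The factor with the hole is itself a product starting with `⌊x⌋`; the induction hypothesis
    -- tells on which side of the split the hole lies.
    · rcases ih h' with ⟨d', hd', h'', rfl⟩ | ⟨d', hd', rfl, rfl⟩
      · exact .inl ⟨d', hd', h'', by simp only [mul_assoc]⟩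
      · exact .inr ⟨_, hd'.mulRight b, rfl, by simp only [mul_assoc]⟩

end BrWord

/-! ### Linear extension of contexts and leading monomials -/

namespace BrAlg

open BrWord

variable {k : Type u} {X : Type v} [CommRing k]

/-- The linear extension of a map of words. -/
noncomputable def mapWords (c : BrWord X → BrWord X) : BrAlg k X →ₗ[k] BrAlg k X :=
  MonoidAlgebra.mapDomainLinearMap k k c

@[simp]
theorem mapWords_word (c : BrWord X → BrWord X) (a : BrWord X) :
    mapWords c (word k a) = word k (c a) :=
  MonoidAlgebra.mapDomainLinearMap_single c 1 a

@[simp]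
theorem bracket_word (a : BrWord X) : bracket (word k a) = word k (.br a) :=
  MonoidAlgebra.mapDomain_single

@[simp]
theorem word_mul_word (a b : BrWord X) : word k a * word k b = word k (a * b) := by
  simp [word, MonoidAlgebra.single_mul_single]

theorem coeff_word (a b : BrWord X) [Decidable (a = b)] :
    (word k a).coeff b = if a = b then 1 else 0 :=
  Finsupp.single_apply

theorem span_range_word : Submodule.span k (Set.range (word k : BrWord X → BrAlg k X)) = ⊤ :=
  (MonoidAlgebra.basis (BrWord X) k).span_eq

theorem ext_word {M : Type*} [AddCommGroup M] [Module k M] {f g : BrAlg k X →ₗ[k] M}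
    (h : ∀ a, f (word k a) = g (word k a)) : f = g :=
  (MonoidAlgebra.basis (BrWord X) k).ext h

theorem linearIndependent_word : LinearIndependent k (word k : BrWord X → BrAlg k X) :=
  (MonoidAlgebra.basis (BrWord X) k).linearIndependent

theorem mapWords_id : mapWords (fun a : BrWord X => a) = (LinearMap.id : BrAlg k X →ₗ[k] _) :=
  ext_word fun a => by simp

theorem mapWords_br (c : BrWord X → BrWord X) (f : BrAlg k X) :
    mapWords (fun a => .br (c a)) f = bracket (mapWords c f) := by
  have : mapWords (fun a => .br (c a)) = (bracket : BrAlg k X →ₗ[k] _) ∘ₗ mapWords c :=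
    ext_word fun a => by simp
  exact congrArg (· f) this

theorem mapWords_mul_left (b : BrWord X) (c : BrWord X → BrWord X) (f : BrAlg k X) :
    mapWords (fun a => b * c a) f = word k b * mapWords c f := by
  have : mapWords (fun a => b * c a) = LinearMap.mulLeft k (word k b) ∘ₗ mapWords c :=
    ext_word fun a => by simp
  exact congrArg (· f) this

theorem mapWords_mul_right (b : BrWord X) (c : BrWord X → BrWord X) (f : BrAlg k X) :
    mapWords (fun a => c a * b) f = mapWords c f * word k b := by
  have : mapWords (fun a => c a * b) = LinearMap.mulRight k (word k b) ∘ₗ mapWords c :=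
    ext_word fun a => by simp
  exact congrArg (· f) this

theorem mapWords_rbElement (lam : k) (c : BrWord X → BrWord X) (x y : BrWord X) :
    mapWords c (rbElement lam x y) = word k (c (.br (.br x * y))) + word k (c (.br (x * .br y)))
      + lam • word k (c (.br (x * y))) - word k (c (.br x * .br y)) := by
  simp [rbElement]

variable [LinearOrder X]

theorem eq_or_pathLT_of_coeff_ne_zero {c : BrWord X → BrWord X} (hc : IsContext c) (lam : k)
    (x y m : BrWord X) (h : (mapWords c (rbElement lam x y)).coeff m ≠ 0) :
    m = c (.br (.br x * y)) ∨ PathLT m (c (.br (.br x * y))) := by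
  classical
  rw [mapWords_rbElement] at h
  by_cases h₁ : c (.br (x * .br y)) = m
  · exact .inr (h₁ ▸ (hc.pathShorter (pathShorter_br_mul_br x y)).pathLT)
  by_cases h₂ : c (.br (x * y)) = m
  · exact .inr (h₂ ▸ (hc.pathShorter (pathShorter_br_mul x y)).pathLT)
  by_cases h₃ : c (.br x * .br y) = m
  · exact .inr (h₃ ▸ (hc.pathShorter (pathShorter_mul_br x y)).pathLT)
  by_cases h₄ : c (.br (.br x * y)) = m
  · exact .inl h₄.symm
  · simp [coeff_word, h₁, h₂, h₃, h₄] at h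

variable [WellFoundedLT X]

/-- The other three monomials are strictly smaller, hence different words, so nothing cancels the
leading coefficient. -/
theorem coeff_mapWords_rbElement {c : BrWord X → BrWord X} (hc : IsContext c) (lam : k)
    (x y : BrWord X) :
    (mapWords c (rbElement lam x y)).coeff (c (.br (.br x * y))) = 1 := by
  classical
  have h : ∀ {a b : BrWord X}, PathShorter a b → c a ≠ c b := fun {a b} h e =>
    not_pathLT_self (c b) (e ▸ (hc.pathShorter h).pathLT)
  rw [mapWords_rbElement]
  simp [coeff_word, h (pathShorter_br_mul_br x y), h (pathShorter_br_mul x y),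
    h (pathShorter_mul_br x y)]

theorem isLeading_mapWords_rbElement [Nontrivial k] {c : BrWord X → BrWord X} (hc : IsContext c)
    (lam : k) (x y : BrWord X) :
    IsLeading PathLT (mapWords c (rbElement lam x y)) (c (.br (.br x * y))) := by
  refine ⟨?_, fun m hm hne => (eq_or_pathLT_of_coeff_ne_zero hc lam x y m hm).resolve_left hne⟩
  rw [coeff_mapWords_rbElement hc]
  exact one_ne_zero

theorem IsLeading.unique {f : BrAlg k X} {m m' : BrWord X} (h : IsLeading PathLT f m)
    (h' : IsLeading PathLT f m') : m = m' := by
  by_contra hne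
  exact asymm_of PathLT (h.2 m' h'.1 (Ne.symm hne)) (h'.2 m h.1 hne)

variable [Nontrivial k]

theorem isLeading_rbElement (lam : k) (x y : BrWord X) :
    IsLeading PathLT (rbElement lam x y) (.br (.br x * y)) := by
  simpa only [mapWords_id, LinearMap.id_apply] using
    isLeading_mapWords_rbElement IsContext.id lam x y

theorem isTrivialMod_mapWords {c : BrWord X → BrWord X} (hc : IsContext c) (lam : k)
    {x y w : BrWord X} (h : PathLT (c (.br (.br x * y))) w) :
    IsTrivialMod PathLT (rbSet X lam) w (mapWords c (rbElement lam x y)) := by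
  obtain ⟨q, rfl⟩ := hc.exists_subst_eq
  exact Submodule.subset_span ⟨q, _, ⟨x, y, rfl⟩, rfl, _, isLeading_mapWords_rbElement hc lam x y, h⟩

theorem isTrivialMod_rbElement (lam : k) {x y w : BrWord X} (h : PathLT (.br (.br x * y)) w) :
    IsTrivialMod PathLT (rbSet X lam) w (rbElement lam x y) := by
  simpa only [mapWords_id, LinearMap.id_apply] using isTrivialMod_mapWords IsContext.id lam h

end BrAlg

/-! ### Triviality of the compositions -/

namespace BrAlg

open BrWord

variable {k : Type u} {X : Type v} [CommRing k] [LinearOrder X] [WellFoundedLT X] [Nontrivial k]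

/-- The composition of `⌊⌊⌊x⌋y⌋z⌋` with its subword `⌊⌊x⌋y⌋`. -/
theorem isTrivialMod_nested (lam : k) (x y z : BrWord X) :
    IsTrivialMod PathLT (rbSet X lam) (.br (.br (.br x * y) * z))
      (rbElement lam (.br x * y) z - mapWords (fun a => .br (a * z)) (rbElement lam x y)) := by
  -- The first six terms reduce the six monomials left in the difference. Reduction by `f(x,⌊y⌋z)`
  -- produces `⌊x⌊⌊y⌋z⌋⌋` and `⌊x⌋⌊⌊y⌋z⌋`, which the last two terms reduce.
  have e : rbElement lam (.br x * y) z - mapWords (fun a => .br (a * z)) (rbElement lam x y) =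
      rbElement lam x (y * .br z) + lam • rbElement lam x (y * z)
        - mapWords (fun a => a * .br z) (rbElement lam x y) - rbElement lam (x * .br y) z
        - lam • rbElement lam (x * y) z + rbElement lam x (.br y * z)
        - mapWords (fun a => .br (x * a)) (rbElement lam y z)
        + mapWords (fun a => .br x * a) (rbElement lam y z) := by
    simp only [mapWords_rbElement]
    simp only [rbElement, mul_assoc]
    module
  rw [e]
  refine add_mem (sub_mem (add_mem (sub_mem (sub_mem (sub_mem (add_mem ?_
    (Submodule.smul_mem _ lam ?_)) ?_) ?_) (Submodule.smul_mem _ lam ?_)) ?_) ?_) ?_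
  · refine isTrivialMod_rbElement lam (PathShorter.of_firstLen_lt ?_ ?_ ?_).pathLT
    · simp [add_assoc]
    · simp
    · simp
  · refine isTrivialMod_rbElement lam (PathShorter.of_firstLen_lt ?_ ?_ ?_).pathLT
    · simp [add_assoc]
    · simp
    · simp
  · refine isTrivialMod_mapWords (IsContext.id.mulRight _) lam
      (PathShorter.of_firstLen_lt ?_ ?_ ?_).pathLT
    · simp [add_assoc]
    · simp
    · simp
  · refine isTrivialMod_rbElement lam (PathShorter.of_firstLen_lt ?_ ?_ ?_).pathLT
    · simp [add_assoc]
    · simp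
    · simp only [firstLen_br, firstLen_mul, breadth_br]; split_ifs <;> omega
  · refine isTrivialMod_rbElement lam (PathShorter.of_firstLen_lt ?_ ?_ ?_).pathLT
    · simp [add_assoc]
    · simp
    · simp only [firstLen_br, firstLen_mul, breadth_br]; split_ifs <;> omega
  · refine isTrivialMod_rbElement lam (PathShorter.of_firstLen_lt ?_ ?_ ?_).pathLT
    · simp [add_assoc]
    · simp
    · simp
  · refine isTrivialMod_mapWords (IsContext.id.mulLeft _).br lam
      (PathShorter.of_firstLen_lt ?_ ?_ ?_).pathLT
    · simp [add_assoc]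
    · simp
    · simp only [firstLen_br, firstLen_mul, breadth_br]; split_ifs <;> omega
  · refine isTrivialMod_mapWords (IsContext.id.mulLeft _) lam
      (PathShorter.of_firstLen_lt ?_ ?_ ?_).pathLT
    · simp [add_assoc]
    · simp
    · simp

/-- The composition of `⌊⌊x⌋y⌋` with a subword of `x`. -/
theorem isTrivialMod_left {c : BrWord X → BrWord X} (hc : IsContext c) (lam : k)
    (x y z : BrWord X) :
    IsTrivialMod PathLT (rbSet X lam) (.br (.br (c (.br (.br x * y))) * z))
      (rbElement lam (c (.br (.br x * y))) z
        - mapWords (fun a => .br (.br (c a) * z)) (rbElement lam x y)) := by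
  -- Extend `f(·,z)` linearly and expand its value at `c|_{f(x,y)}` in two ways, by the four
  -- monomials of `f(x,y)` or by the four terms of `f(·,z)`; then solve for the composition.
  have e : rbElement lam (c (.br (.br x * y))) z
        - mapWords (fun a => .br (.br (c a) * z)) (rbElement lam x y) =
      rbElement lam (c (.br x * .br y)) z - rbElement lam (c (.br (x * .br y))) z
        - lam • rbElement lam (c (.br (x * y))) z
        + mapWords (fun a => .br (c a * .br z)) (rbElement lam x y)
        + lam • mapWords (fun a => .br (c a * z)) (rbElement lam x y)
        - mapWords (fun a => .br (c a) * .br z) (rbElement lam x y) := by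
    simp only [mapWords_rbElement]
    simp only [rbElement]
    module
  have lt {a b : BrWord X} (h : PathShorter a b) :
      PathLT (.br (.br (c a) * z)) (.br (.br (c b) * z)) :=
    ((hc.pathShorter h).br.mul_right z).br.pathLT
  rw [e]
  exact sub_mem (add_mem (add_mem (sub_mem (sub_mem
    (isTrivialMod_rbElement lam (lt (pathShorter_mul_br x y)))
    (isTrivialMod_rbElement lam (lt (pathShorter_br_mul_br x y))))
    (Submodule.smul_mem _ lam (isTrivialMod_rbElement lam (lt (pathShorter_br_mul x y)))))
    (isTrivialMod_mapWords (hc.mulRight _).br lam (pathShorter_br_mul_br _ z).pathLT))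
    (Submodule.smul_mem _ lam
      (isTrivialMod_mapWords (hc.mulRight _).br lam (pathShorter_br_mul _ z).pathLT)))
    (isTrivialMod_mapWords (hc.br.mulRight _) lam (pathShorter_mul_br _ z).pathLT)

/-- The composition of `⌊⌊x⌋y⌋` with a subword of `y`. -/
theorem isTrivialMod_right {c : BrWord X → BrWord X} (hc : IsContext c) (lam : k)
    (x y z : BrWord X) :
    IsTrivialMod PathLT (rbSet X lam) (.br (.br z * c (.br (.br x * y))))
      (rbElement lam z (c (.br (.br x * y)))
        - mapWords (fun a => .br (.br z * c a)) (rbElement lam x y)) := by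
  -- The same double expansion, now of `f(z,·)` at `c|_{f(x,y)}`.
  have e : rbElement lam z (c (.br (.br x * y)))
        - mapWords (fun a => .br (.br z * c a)) (rbElement lam x y) =
      rbElement lam z (c (.br x * .br y)) - rbElement lam z (c (.br (x * .br y)))
        - lam • rbElement lam z (c (.br (x * y)))
        + mapWords (fun a => .br (z * .br (c a))) (rbElement lam x y)
        + lam • mapWords (fun a => .br (z * c a)) (rbElement lam x y)
        - mapWords (fun a => .br z * .br (c a)) (rbElement lam x y) := by
    simp only [mapWords_rbElement]
    simp only [rbElement]
    module
  have lt {a b : BrWord X} (h : PathShorter a b) :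
      PathLT (.br (.br z * c a)) (.br (.br z * c b)) :=
    ((hc.pathShorter h).mul_left _).br.pathLT
  rw [e]
  exact sub_mem (add_mem (add_mem (sub_mem (sub_mem
    (isTrivialMod_rbElement lam (lt (pathShorter_mul_br x y)))
    (isTrivialMod_rbElement lam (lt (pathShorter_br_mul_br x y))))
    (Submodule.smul_mem _ lam (isTrivialMod_rbElement lam (lt (pathShorter_br_mul x y)))))
    (isTrivialMod_mapWords (hc.br.mulLeft _).br lam (pathShorter_br_mul_br z _).pathLT))
    (Submodule.smul_mem _ lam
      (isTrivialMod_mapWords (hc.mulLeft _).br lam (pathShorter_br_mul z _).pathLT)))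
    (isTrivialMod_mapWords (hc.br.mulLeft _) lam (pathShorter_mul_br z _).pathLT)

theorem isTrivialMod_including {c : BrWord X → BrWord X} (hc : IsContext c) (lam : k)
    {x y x' y' : BrWord X} (h : c (.br (.br x' * y')) = .br (.br x * y)) :
    IsTrivialMod PathLT (rbSet X lam) (.br (.br x * y))
      (rbElement lam x y - mapWords c (rbElement lam x' y')) := by
  rcases hc.eq_id_or_of_apply_eq_br h with rfl | ⟨d, hd, hd', rfl⟩
  · obtain ⟨rfl, rfl⟩ := brCons.inj (br.inj h)
    rw [mapWords_id, LinearMap.id_apply, sub_self]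
    exact zero_mem _
  rcases hd.of_apply_eq_br_mul hd' with ⟨e, he, he', rfl⟩ | ⟨e, he, rfl, rfl⟩
  · rcases he.eq_id_or_of_apply_eq_br he' with rfl | ⟨e', hc', rfl, rfl⟩
    · obtain rfl := br.inj he'
      exact isTrivialMod_nested lam x' y' y
    · exact isTrivialMod_left hc' lam x' y' y
  · exact isTrivialMod_right he lam x' y' x

theorem isGroebnerShirshovBasis_rbSet (lam : k) :
    IsGroebnerShirshovBasis PathLT (rbSet X lam) where
  monic := by
    rintro _ ⟨x, y, rfl⟩
    refine ⟨_, isLeading_rbElement lam x y, ?_⟩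
    simpa only [mapWords_id, LinearMap.id_apply] using
      coeff_mapWords_rbElement IsContext.id lam x y
  intersection := by
    rintro _ ⟨x, y, rfl⟩ _ ⟨x', y', rfl⟩ mf mg hf hg a b w - - h h'
    rw [hf.unique (isLeading_rbElement lam x y), hg.unique (isLeading_rbElement lam x' y')] at h h'
    -- Both leading monomials are brackets, so the breadth of `w` would lie strictly between 1 and
    -- 2.
    simp only [breadth_br, max_self] at h h'
    omega
  including := by
    rintro _ ⟨x, y, rfl⟩ _ ⟨x', y', rfl⟩ mf mg hf hg w q hw hq
    rw [hf.unique (isLeading_rbElement lam x y)] at hw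
    rw [hg.unique (isLeading_rbElement lam x' y')] at hq
    subst hw
    exact isTrivialMod_including (isContext_subst q) lam hq.symm

end BrAlg

/-! ### Homomorphisms out of a quotient -/

namespace OperatedIdeal

variable {k : Type u} {A : Type v} [CommRing k] [NonUnitalRing A] [Module k A] {P : A →ₗ[k] A}

theorem subset_generate (S : Set A) : S ⊆ ((generate P S).toSubmodule : Set A) :=
  fun _ hx _ hI => hI hx

theorem generate_le {S : Set A} {I : OperatedIdeal P} (h : S ⊆ (I.toSubmodule : Set A)) :
    (generate P S).toSubmodule ≤ I.toSubmodule :=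
  fun _ hx => hx I h

variable {B : Type w} [NonUnitalRing B] [Module k B]

/-- The kernel of a homomorphism that intertwines the operators. -/
def ker (φ : A →ₙₐ[k] B) {Q : B →ₗ[k] B} (hφ : ∀ a, φ (P a) = Q (φ a)) : OperatedIdeal P where
  carrier := {x | φ x = 0}
  zero_mem' := map_zero φ
  add_mem' := fun {x y} (hx : φ x = 0) (hy : φ y = 0) => by simp [hx, hy]
  smul_mem' := fun c x (hx : φ x = 0) => by simp [hx]
  mul_left_mem' := fun a {x} (hx : φ x = 0) => by simp [hx]
  mul_right_mem' := fun a {x} (hx : φ x = 0) => by simp [hx]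
  map_mem' := fun {x} (hx : φ x = 0) => by simp [hφ, hx]

/-- The homomorphism induced on the quotient by a homomorphism that vanishes on the ideal. -/
def Quotient.lift (I : OperatedIdeal P) (φ : A →ₙₐ[k] B)
    (h : ∀ x ∈ I.toSubmodule, φ x = 0) : I.Quotient →ₙₐ[k] B where
  toFun := I.toSubmodule.liftQ (φ : A →ₗ[k] B) h
  map_smul' := fun c x => map_smul (I.toSubmodule.liftQ (φ : A →ₗ[k] B) h) c x
  map_zero' := map_zero (I.toSubmodule.liftQ (φ : A →ₗ[k] B) h)
  map_add' := fun x y => map_add (I.toSubmodule.liftQ (φ : A →ₗ[k] B) h) x y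
  map_mul' := fun x y => by
    obtain ⟨x, rfl⟩ := mk_surjective I x
    obtain ⟨y, rfl⟩ := mk_surjective I y
    exact map_mul φ x y

@[simp]
theorem Quotient.lift_mk (I : OperatedIdeal P) (φ : A →ₙₐ[k] B)
    (h : ∀ x ∈ I.toSubmodule, φ x = 0) (x : A) : Quotient.lift I φ h (mk I x) = φ x := rfl

end OperatedIdeal

/-- It suffices to check the Rota–Baxter identity on a spanning set. -/
theorem isRotaBaxter_of_span {k : Type u} [CommRing k] {A : Type v} [NonUnitalRing A] [Module k A]
    [IsScalarTower k A A] [SMulCommClass k A A] {lam : k} {P : A →ₗ[k] A} {s : Set A}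
    (hs : Submodule.span k s = ⊤)
    (h : ∀ x ∈ s, ∀ y ∈ s, P x * P y = P (P x * y) + P (x * P y) + lam • P (x * y)) :
    IsRotaBaxter lam P := by
  intro x y
  have hx : x ∈ Submodule.span k s := hs ▸ Submodule.mem_top
  have hy : y ∈ Submodule.span k s := hs ▸ Submodule.mem_top
  induction hx using Submodule.span_induction with
  | zero => simp
  | add a b _ _ iha ihb => simp only [map_add, add_mul, iha, ihb, smul_add]; abel
  | smul c a _ ih => simp only [map_smul, smul_mul_assoc, ih, smul_add, smul_comm lam c]
  | mem a ha =>
    induction hy using Submodule.span_induction with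
    | zero => simp
    | add b c _ _ ihb ihc => simp only [map_add, mul_add, ihb, ihc, smul_add]; abel
    | smul c b _ ih => simp only [map_smul, mul_smul_comm, ih, smul_add, smul_comm lam c]
    | mem b hb => exact h a ha b hb

namespace BrAlg

open BrWord

/-! ### The universal property -/

section Universal

variable {k : Type u} {X : Type v} [CommRing k] {A : Type w} [NonUnitalRing A] [Module k A]

/-- The value of a word in an algebra with an operator `Q`, the letters being evaluated by `g`. -/
def evalWord (Q : A →ₗ[k] A) (g : X → A) : BrWord X → A
  | .of x => g x
  | .br u => Q (evalWord Q g u)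
  | .ofCons x w => g x * evalWord Q g w
  | .brCons u w => Q (evalWord Q g u) * evalWord Q g w

theorem evalWord_mul (Q : A →ₗ[k] A) (g : X → A) (a b : BrWord X) :
    evalWord Q g (a * b) = evalWord Q g a * evalWord Q g b := by
  induction a with
  | of x => rfl
  | br u => rfl
  | ofCons x a ih =>
    change g x * evalWord Q g (a * b) = g x * evalWord Q g a * _
    rw [ih, mul_assoc]
  | brCons u a _ ih =>
    change Q (evalWord Q g u) * evalWord Q g (a * b) = Q (evalWord Q g u) * evalWord Q g a * _
    rw [ih, mul_assoc]

variable [IsScalarTower k A A] [SMulCommClass k A A]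

/-- The homomorphism of operated algebras from the algebra of bracketed words that extends `g`. -/
noncomputable def eval (Q : A →ₗ[k] A) (g : X → A) : BrAlg k X →ₙₐ[k] A :=
  MonoidAlgebra.liftMagma k { toFun := evalWord Q g, map_mul' := evalWord_mul Q g }

@[simp]
theorem eval_word (Q : A →ₗ[k] A) (g : X → A) (a : BrWord X) :
    eval Q g (word k a) = evalWord Q g a := by
  simp [eval, word]

theorem eval_bracket (Q : A →ₗ[k] A) (g : X → A) (f : BrAlg k X) :
    eval Q g (bracket f) = Q (eval Q g f) := by
  have : (eval Q g : BrAlg k X →ₗ[k] A) ∘ₗ bracket = Q ∘ₗ (eval Q g : BrAlg k X →ₗ[k] A) :=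
    ext_word fun a => by simp [evalWord]
  exact congrArg (· f) this

theorem eval_eq_zero_of_mem_rbIdeal {lam : k} {Q : A →ₗ[k] A} (hQ : IsRotaBaxter lam Q)
    (g : X → A) (f : BrAlg k X) (hf : f ∈ (rbIdeal X lam).toSubmodule) : eval Q g f = 0 := by
  refine OperatedIdeal.generate_le (I := OperatedIdeal.ker (eval Q g) (eval_bracket Q g)) ?_ hf
  rintro _ ⟨x, y, rfl⟩
  change eval Q g _ = 0
  simp [rbElement, evalWord_mul, evalWord, hQ (evalWord Q g x) (evalWord Q g y)]

theorem isRotaBaxter_operator_rbIdeal (X : Type v) (lam : k) :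
    IsRotaBaxter lam (OperatedIdeal.Quotient.operator (rbIdeal X lam)) := by
  apply isRotaBaxter_of_span
    (s := OperatedIdeal.Quotient.mk (rbIdeal X lam) '' Set.range (word k))
  · rw [← Submodule.map_span, span_range_word, Submodule.map_top, LinearMap.range_eq_top]
    exact OperatedIdeal.Quotient.mk_surjective _
  · rintro _ ⟨_, ⟨x, rfl⟩, rfl⟩ _ ⟨_, ⟨y, rfl⟩, rfl⟩
    have h : rbElement lam x y ∈ (rbIdeal X lam).toSubmodule :=
      OperatedIdeal.subset_generate _ ⟨x, y, rfl⟩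
    simp only [OperatedIdeal.Quotient.operator_mk, ← OperatedIdeal.Quotient.mk_mul, bracket_word,
      word_mul_word, ← map_add, ← map_smul]
    exact ((OperatedIdeal.Quotient.mk_eq_iff _).mpr h).symm

theorem isFreeRotaBaxter_quotient_rbIdeal (X : Type v) (lam : k) :
    IsFreeRotaBaxter.{u, max u v, w, v} lam (OperatedIdeal.Quotient.operator (rbIdeal X lam))
      (fun x : X => OperatedIdeal.Quotient.mk (rbIdeal X lam) (word k (.of x))) := by
  refine ⟨isRotaBaxter_operator_rbIdeal X lam, fun A _ _ _ _ Q hQ g => ?_⟩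
  refine ⟨OperatedIdeal.Quotient.lift _ (eval Q g) (eval_eq_zero_of_mem_rbIdeal hQ g),
    ⟨fun a => ?_, fun x => ?_⟩, ?_⟩
  · obtain ⟨a, rfl⟩ := OperatedIdeal.Quotient.mk_surjective _ a
    rw [OperatedIdeal.Quotient.operator_mk, OperatedIdeal.Quotient.lift_mk,
      OperatedIdeal.Quotient.lift_mk, eval_bracket]
  · rw [OperatedIdeal.Quotient.lift_mk, eval_word]
    rfl
  · rintro φ ⟨hφ, hφg⟩
    have key : ∀ a, φ (OperatedIdeal.Quotient.mk _ (word k a)) = evalWord Q g a := by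
      intro a
      induction a with
      | of x => exact hφg x
      | br u ih =>
        rw [← bracket_word, ← OperatedIdeal.Quotient.operator_mk, hφ, ih, evalWord]
      | ofCons x a ih =>
        rw [ofCons_eq, ← word_mul_word, OperatedIdeal.Quotient.mk_mul, map_mul, ih, hφg]
        rfl
      | brCons u a ihu ih =>
        rw [brCons_eq, ← word_mul_word, OperatedIdeal.Quotient.mk_mul, map_mul, ih, ← bracket_word,
          ← OperatedIdeal.Quotient.operator_mk, hφ, ihu]
        rfl
    have h : (φ : _ →ₗ[k] A) ∘ₗ OperatedIdeal.Quotient.mk (rbIdeal X lam) =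
        (eval Q g : BrAlg k X →ₗ[k] A) := ext_word fun a => by simpa using key a
    ext a
    obtain ⟨a, rfl⟩ := OperatedIdeal.Quotient.mk_surjective _ a
    exact congrArg (· a) h

end Universal

end BrAlg

/-! ### A Rota–Baxter operator on the algebra of bracketed words -/

namespace BrWord

variable {X : Type v}

/-- The number of brackets that enclose the first letter of a word. -/
def headDepth : BrWord X → ℕ
  | of _ => 0
  | br u => headDepth u + 1
  | ofCons _ _ => 0
  | brCons u _ => headDepth u + 1

@[simp]
theorem headDepth_mul (a b : BrWord X) : (a * b).headDepth = a.headDepth := by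
  cases a <;> rfl

end BrWord

namespace BrAlg

open BrWord

variable {k : Type u} {X : Type v} [CommRing k]

/-- The bracket of a word, rewritten by `⌊⌊u⌋w⌋ = ⌊u⌋⌊w⌋ - ⌊u⌊w⌋⌋ - lam ⌊uw⌋` as long as possible
at the outermost level. -/
noncomputable def rewriteBr (lam : k) : BrWord X → BrAlg k X
  | .of x => word k (.br (.of x))
  | .br u => word k (.br (.br u))
  | .ofCons x w => word k (.br (.ofCons x w))
  | .brCons u w => word k (.br u) * rewriteBr lam w
      - (rewriteBr lam w).coeff.sum
          -- The test serves termination only: it gives `u * z` the degree of `⌊u⌋w`, while its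
          -- first letter lies one bracket less deep. Homogeneity of `rewriteBr lam w` later makes
          -- it vacuous.
          (fun z c => if z.deg = w.deg then c • rewriteBr lam (u * z) else 0)
      - lam • rewriteBr lam (u * w)
termination_by w => (w.deg, w.headDepth)
decreasing_by
  all_goals
    have := u.deg_pos
    simp_wf
    simp [Prod.lex_def, deg, headDepth, *]

end BrAlg

/-! ### Homogeneity and the Rota–Baxter identity of the rewriting operator -/

namespace BrAlg

open BrWord

variable {k : Type u} {X : Type v} [CommRing k]

/-- The homogeneous elements of degree `n`. -/
noncomputable def homog (k : Type u) (X : Type v) [CommRing k] (n : ℕ) :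
    Submodule k (BrAlg k X) :=
  MonoidAlgebra.supported k k {a | a.deg = n}

theorem homog_eq_span (n : ℕ) :
    homog k X n = Submodule.span k (word k '' {a | a.deg = n}) :=
  MonoidAlgebra.supported_eq_span_single _ _

theorem word_mem_homog (a : BrWord X) : word k a ∈ homog k X a.deg := by
  rw [homog_eq_span]
  exact Submodule.subset_span ⟨a, rfl, rfl⟩

theorem map_mem_of_mem_homog {M : Type*} [AddCommGroup M] [Module k M] (φ : BrAlg k X →ₗ[k] M)
    {N : Submodule k M} {n : ℕ} {f : BrAlg k X} (hf : f ∈ homog k X n)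
    (h : ∀ a, a.deg = n → φ (word k a) ∈ N) : φ f ∈ N := by
  rw [homog_eq_span] at hf
  refine (Submodule.span_le (p := N.comap φ)).mpr ?_ hf
  rintro _ ⟨a, ha, rfl⟩
  exact h a ha

theorem word_mul_mem_homog (a : BrWord X) {n : ℕ} {f : BrAlg k X} (hf : f ∈ homog k X n) :
    word k a * f ∈ homog k X (a.deg + n) := by
  refine map_mem_of_mem_homog (LinearMap.mulLeft k (word k a)) hf fun b hb => ?_
  simpa [← hb] using word_mem_homog (k := k) (a * b)

/-- The linear extension of `rewriteBr`. -/
noncomputable def rewriteOp (lam : k) : BrAlg k X →ₗ[k] BrAlg k X :=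
  (MonoidAlgebra.basis (BrWord X) k).constr k (rewriteBr lam)

@[simp]
theorem rewriteOp_word (lam : k) (a : BrWord X) : rewriteOp lam (word k a) = rewriteBr lam a :=
  (MonoidAlgebra.basis (BrWord X) k).constr_basis k _ a

theorem rewriteOp_mul (lam : k) (u : BrWord X) (f : BrAlg k X) :
    rewriteOp lam (word k u * f) = f.coeff.sum fun z c => c • rewriteBr lam (u * z) := by
  conv_lhs => rw [← MonoidAlgebra.sum_coeff_single f]
  simp only [Finsupp.sum, Finset.mul_sum, map_sum]
  refine Finset.sum_congr rfl fun z _ => ?_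
  have : MonoidAlgebra.single z (f.coeff z) = f.coeff z • word k z := by simp [word]
  rw [this, mul_smul_comm, map_smul, word_mul_word, rewriteOp_word]

theorem rewriteBr_brCons_of_mem (lam : k) (u w : BrWord X)
    (h : rewriteBr lam w ∈ homog k X w.deg) :
    rewriteBr lam (.brCons u w) = word k (.br u) * rewriteBr lam w
      - rewriteOp lam (word k u * rewriteBr lam w) - lam • rewriteBr lam (u * w) := by
  have e : ((rewriteBr lam w).coeff.sum
      fun z c => if z.deg = w.deg then c • rewriteBr lam (u * z) else 0) =
      rewriteOp lam (word k u * rewriteBr lam w) := by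
    rw [rewriteOp_mul]
    exact Finset.sum_congr rfl fun z hz => if_pos (MonoidAlgebra.mem_supported.mp h hz)
  rw [← e]
  exact rewriteBr.eq_4 lam u w

/-- Induction on the degree and then on the depth of the first letter. -/
theorem headDepth_induction {p : BrWord X → Prop}
    (ih : ∀ a, (∀ b : BrWord X, b.deg < a.deg ∨ b.deg = a.deg ∧ b.headDepth < a.headDepth → p b) →
      p a) (a : BrWord X) : p a := by
  have wf : WellFounded (InvImage (Prod.Lex (· < ·) (· < ·))
      fun a : BrWord X => (a.deg, a.headDepth)) :=
    InvImage.wf _ (WellFounded.prod_lex Nat.lt_wfRel.wf Nat.lt_wfRel.wf)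
  exact wf.induction a fun a h => ih a fun b hb => h b (Prod.lex_def.mpr hb)

/-- For `⌊u⌋w` the induction gives homogeneity of the value at `w` first, which removes the degree
test from the recursion; the words `uz` that remain are smaller by head depth. -/
theorem rewriteBr_mem_homog (lam : k) (a : BrWord X) : rewriteBr lam a ∈ homog k X a.deg := by
  induction a using headDepth_induction with
  | ih a ih =>
    cases a with
    | of x => rw [rewriteBr]; exact word_mem_homog _
    | br u => rw [rewriteBr]; exact word_mem_homog _
    | ofCons x w => rw [rewriteBr]; exact word_mem_homog _
    | brCons u w =>
      have hw : rewriteBr lam w ∈ homog k X w.deg := by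
        apply ih
        have := u.deg_pos
        left; simp only [deg]; omega
      have hu : ∀ z : BrWord X, z.deg = w.deg →
          rewriteBr lam (u * z) ∈ homog k X (brCons u w).deg := fun z hz => by
        have e : (brCons u w).deg = (u * z).deg := by simp [deg, hz]
        rw [e]
        refine ih _ (.inr ⟨e.symm, ?_⟩)
        simp [headDepth]
      rw [rewriteBr_brCons_of_mem _ _ _ hw]
      refine sub_mem (sub_mem (word_mul_mem_homog (.br u) hw) ?_)
        (Submodule.smul_mem _ _ (hu w rfl))
      refine map_mem_of_mem_homog (rewriteOp lam ∘ₗ LinearMap.mulLeft k (word k u)) hw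
        fun z hz => ?_
      simpa using hu z hz

/-- The recursion made linear in the second factor: it is the Rota–Baxter identity with the plain
bracket `⌊u⌋` in place of the operator at `u`. -/
theorem rewriteOp_br_mul (lam : k) (u : BrWord X) (f : BrAlg k X) :
    rewriteOp lam (word k (.br u) * f) = word k (.br u) * rewriteOp lam f
      - rewriteOp lam (word k u * rewriteOp lam f) - lam • rewriteOp lam (word k u * f) := by
  have : rewriteOp lam ∘ₗ LinearMap.mulLeft k (word k (.br u)) =
      LinearMap.mulLeft k (word k (.br u)) ∘ₗ rewriteOp lam
        - rewriteOp lam ∘ₗ LinearMap.mulLeft k (word k u) ∘ₗ rewriteOp lam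
        - lam • (rewriteOp lam ∘ₗ LinearMap.mulLeft k (word k u)) :=
    ext_word fun a => by
      simpa [brCons_eq] using rewriteBr_brCons_of_mem lam u a (rewriteBr_mem_homog lam a)
  exact congrArg (· f) this

/-- The elements that satisfy the Rota–Baxter identity for `rewriteOp` as left factor. -/
noncomputable def rbLeft (lam : k) : Submodule k (BrAlg k X) where
  carrier := {g | ∀ f, rewriteOp lam g * rewriteOp lam f = rewriteOp lam (rewriteOp lam g * f)
    + rewriteOp lam (g * rewriteOp lam f) + lam • rewriteOp lam (g * f)}
  zero_mem' := fun f => by simp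
  add_mem' := fun {a b} ha hb f => by
    simp only [map_add, add_mul, ha f, hb f, smul_add]; abel
  smul_mem' := fun c a ha f => by
    simp only [map_smul, smul_mul_assoc, ha f, smul_add, smul_comm lam c]

theorem mem_rbLeft {lam : k} {g : BrAlg k X} : g ∈ rbLeft lam ↔ ∀ f,
    rewriteOp lam g * rewriteOp lam f = rewriteOp lam (rewriteOp lam g * f)
      + rewriteOp lam (g * rewriteOp lam f) + lam • rewriteOp lam (g * f) := Iff.rfl

theorem word_mem_rbLeft_of_rewriteBr_eq {lam : k} {a : BrWord X}
    (h : rewriteBr lam a = word k (.br a)) : word k a ∈ rbLeft lam := fun f => by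
  rw [rewriteOp_word, h, rewriteOp_br_mul]
  abel

/-- Write `R` for `rewriteOp lam`. Unless `a = ⌊x⌋y`, `R(a)` is the plain bracket and the recursion
is the identity. Otherwise `R(⌊x⌋y) = ⌊x⌋R(y) - R(xR(y)) - λR(xy)` reduces the identity to those
with left factors `y`, `xR(y)` and `xy`, which precede `a` in the induction. -/
theorem word_mem_rbLeft (lam : k) (a : BrWord X) : word k a ∈ rbLeft lam := by
  induction a using headDepth_induction with
  | ih a ih =>
    cases a with
    | of x => exact word_mem_rbLeft_of_rewriteBr_eq (by rw [rewriteBr])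
    | br u => exact word_mem_rbLeft_of_rewriteBr_eq (by rw [rewriteBr])
    | ofCons x w => exact word_mem_rbLeft_of_rewriteBr_eq (by rw [rewriteBr])
    | brCons x y =>
      have hu : ∀ z : BrWord X, z.deg = y.deg → word k (x * z) ∈ rbLeft lam := fun z hz => by
        refine ih _ (.inr ⟨by simp [deg, hz], ?_⟩)
        simp [headDepth]
      have h₁ := mem_rbLeft.mp (ih y (by have := x.deg_pos; left; simp only [deg]; omega))
      have h₂ := mem_rbLeft.mp (hu y rfl)
      -- By homogeneity this is a combination of words `xz` with `z` of the degree of `y`, to which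
      -- the induction applies.
      have h₃ : word k x * rewriteOp lam (word k y) ∈ rbLeft lam := by
        refine map_mem_of_mem_homog (LinearMap.mulLeft k (word k x))
          (rewriteOp_word lam y ▸ rewriteBr_mem_homog lam y) fun z hz => ?_
        simpa using hu z hz
      rw [mem_rbLeft] at h₃
      intro f
      rw [← word_mul_word] at h₂
      rw [brCons_eq, ← word_mul_word]
      have D := rewriteOp_br_mul lam x
      simp only [mul_assoc] at h₂ h₃ ⊢
      simp only [D, sub_mul, smul_mul_assoc, mul_assoc, h₁, h₂, h₃, map_sub, map_add, map_smul,
        mul_add, mul_smul_comm]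
      module

theorem isRotaBaxter_rewriteOp (lam : k) :
    IsRotaBaxter lam (rewriteOp lam : BrAlg k X →ₗ[k] BrAlg k X) := by
  refine isRotaBaxter_of_span span_range_word ?_
  rintro _ ⟨a, rfl⟩ y -
  exact word_mem_rbLeft lam a y

/-! ### Irreducible words -/

theorem mem_rbIrr_iff {a : BrWord X} : a ∈ rbIrr X ↔
    ∀ c, IsContext c → ∀ x y : BrWord X, a ≠ c (.br (.br x * y)) := by
  constructor
  · rintro h c hc x y rfl
    obtain ⟨q, rfl⟩ := hc.exists_subst_eq
    exact h ⟨q, x, y, rfl⟩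
  · rintro h ⟨q, x, y, e⟩
    exact h _ (isContext_subst q) x y e

theorem mem_rbIrr_of_apply_mem {c : BrWord X → BrWord X} {a : BrWord X}
    (hc : ∀ {d : BrWord X → BrWord X}, IsContext d → IsContext fun t => c (d t))
    (h : c a ∈ rbIrr X) : a ∈ rbIrr X := by
  rw [mem_rbIrr_iff] at h ⊢
  rintro d hd x y rfl
  exact h _ (hc hd) x y rfl

/-- No bracket in an irreducible word has the form `⌊⌊x⌋y⌋`, so the rewriting operator only ever
acts as the plain bracket. -/
theorem evalWord_rewriteOp_of_mem_rbIrr (lam : k) {a : BrWord X} (ha : a ∈ rbIrr X) :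
    evalWord (rewriteOp lam) (fun x => word k (.of x)) a = word k a := by
  induction a with
  | of x => rfl
  | br u ih =>
    rw [evalWord, ih (mem_rbIrr_of_apply_mem IsContext.br ha), rewriteOp_word]
    cases u with
    | of x => rw [rewriteBr]
    | br u => rw [rewriteBr]
    | ofCons x w => rw [rewriteBr]
    | brCons x y => exact absurd rfl (mem_rbIrr_iff.mp ha _ .id x y)
  | ofCons x w ih =>
    rw [evalWord, ih (mem_rbIrr_of_apply_mem (c := fun t => .of x * t) (.mulLeft _) ha),
      word_mul_word, ofCons_eq]
  | brCons u w ihu ihw =>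
    have hw := ihw (mem_rbIrr_of_apply_mem (c := fun t => .br u * t) (.mulLeft _) ha)
    have hb : br u ∈ rbIrr X := mem_rbIrr_of_apply_mem (c := fun t => t * w) (.mulRight _) ha
    have hu := ihu (mem_rbIrr_of_apply_mem IsContext.br hb)
    rw [evalWord, hw, hu, rewriteOp_word, brCons_eq, ← word_mul_word]
    congr 1
    cases u with
    | of x => rw [rewriteBr]
    | br u => rw [rewriteBr]
    | ofCons x w => rw [rewriteBr]
    | brCons x y => exact absurd rfl (mem_rbIrr_iff.mp hb _ .id x y)

/-- The map induced on the quotient by evaluation with `rewriteOp` sends the classes of irreducible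
words to these words themselves, which are distinct basis elements of `BrAlg k X`. -/
theorem linearIndependent_rbIrr (lam : k) : LinearIndependent k (fun a : rbIrr X =>
    OperatedIdeal.Quotient.mk (rbIdeal X lam) (word k (a : BrWord X))) := by
  let φ := OperatedIdeal.Quotient.lift (rbIdeal X lam)
    (eval (rewriteOp lam) fun x => word k (.of x))
    (eval_eq_zero_of_mem_rbIdeal (isRotaBaxter_rewriteOp lam) _)
  refine LinearIndependent.of_comp (φ : _ →ₗ[k] BrAlg k X) ?_
  convert (linearIndependent_word (k := k) (X := X)).comp _
    (Subtype.val_injective (p := (· ∈ rbIrr X))) using 1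
  ext1 a
  simpa [φ] using evalWord_rewriteOp_of_mem_rbIrr lam a.2

theorem mapWords_mem (I : OperatedIdeal (bracket : BrAlg k X →ₗ[k] BrAlg k X))
    {c : BrWord X → BrWord X} (hc : IsContext c) {f : BrAlg k X} (hf : f ∈ I.toSubmodule) :
    mapWords c f ∈ I.toSubmodule := by
  induction hc with
  | id => rwa [mapWords_id]
  | br _ ih => rw [mapWords_br]; exact I.map_mem' ih
  | mulLeft b _ ih => rw [mapWords_mul_left]; exact I.mul_left_mem' _ ih
  | mulRight b _ ih => rw [mapWords_mul_right]; exact I.mul_right_mem' _ ih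

/-- Modulo the ideal, a reducible word `c(⌊⌊x⌋y⌋)` is a combination of three strictly smaller words,
so well-founded induction on `PathLT` applies. -/
theorem span_rbIrr [LinearOrder X] [WellFoundedLT X] (lam : k) :
    Submodule.span k (Set.range fun a : rbIrr X =>
      OperatedIdeal.Quotient.mk (rbIdeal X lam) (word k (a : BrWord X))) = ⊤ := by
  set N := Submodule.span k (Set.range fun a : rbIrr X =>
    OperatedIdeal.Quotient.mk (rbIdeal X lam) (word k (a : BrWord X)))
  have key : ∀ a, OperatedIdeal.Quotient.mk (rbIdeal X lam) (word k a) ∈ N := by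
    intro a
    refine wellFounded_pathLT.induction
      (C := fun a => OperatedIdeal.Quotient.mk (rbIdeal X lam) (word k a) ∈ N) a fun a ih => ?_
    by_cases ha : a ∈ rbIrr X
    · exact Submodule.subset_span ⟨⟨a, ha⟩, rfl⟩
    rw [mem_rbIrr_iff] at ha
    push Not at ha
    obtain ⟨c, hc, x, y, rfl⟩ := ha
    have h0 : OperatedIdeal.Quotient.mk (rbIdeal X lam) (mapWords c (rbElement lam x y)) = 0 := by
      rw [← map_zero (OperatedIdeal.Quotient.mk (rbIdeal X lam)),
        OperatedIdeal.Quotient.mk_eq_iff, sub_zero]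
      exact mapWords_mem _ hc (OperatedIdeal.subset_generate _ ⟨x, y, rfl⟩)
    rw [mapWords_rbElement, map_sub, map_add, map_add, map_smul, sub_eq_zero, add_assoc,
      ← eq_sub_iff_add_eq] at h0
    rw [h0]
    exact sub_mem (ih _ (hc.pathShorter (pathShorter_mul_br x y)).pathLT)
      (add_mem (ih _ (hc.pathShorter (pathShorter_br_mul_br x y)).pathLT)
        (Submodule.smul_mem _ _ (ih _ (hc.pathShorter (pathShorter_br_mul x y)).pathLT)))
  rw [eq_top_iff]
  rintro f -
  obtain ⟨f, rfl⟩ := OperatedIdeal.Quotient.mk_surjective _ f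
  have hf : f ∈ Submodule.span k (Set.range (word k : BrWord X → BrAlg k X)) :=
    span_range_word (k := k) (X := X) ▸ Submodule.mem_top
  refine (Submodule.span_le (p := N.comap (OperatedIdeal.Quotient.mk (rbIdeal X lam)))).mpr ?_ hf
  rintro _ ⟨a, rfl⟩
  exact key a

end BrAlg

theorem theorem4p2 {k : Type u} [CommRing k] [CharZero k] {X : Type v} [LinearOrder X]
    [WellFoundedLT X] (lam : k) :
    -- the strict part of the comparison of words is a well-founded strict weak order
    (IsStrictWeakOrder (BrWord X) BrWord.PathLT ∧
      WellFounded (BrWord.PathLT : BrWord X → BrWord X → Prop)) ∧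
    -- leading monomials
    (∀ x y : BrWord X,
      BrAlg.IsLeading BrWord.PathLT (rbElement lam x y) (.br (.br x * y))) ∧
    (∀ (q : StarWord X) (x y : BrWord X),
      BrAlg.IsLeading BrWord.PathLT (BrAlg.subst q (rbElement lam x y))
        (q.subst (.br (.br x * y)))) ∧
    -- Gröbner–Shirshov basis
    BrAlg.IsGroebnerShirshovBasis BrWord.PathLT (rbSet X lam) ∧
    -- the quotient is the free nonunitary Rota–Baxter algebra
    IsFreeRotaBaxter.{u, max u v, w, v} lam
      (OperatedIdeal.Quotient.operator (rbIdeal X lam))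
      (fun x : X => OperatedIdeal.Quotient.mk (rbIdeal X lam) (BrAlg.word k (.of x))) ∧
    -- the irreducible words form a basis of it
    LinearIndependent k (fun a : rbIrr X =>
      OperatedIdeal.Quotient.mk (rbIdeal X lam) (BrAlg.word k (a : BrWord X))) ∧
    Submodule.span k (Set.range (fun a : rbIrr X =>
      OperatedIdeal.Quotient.mk (rbIdeal X lam) (BrAlg.word k (a : BrWord X)))) = ⊤ := by
  exact ⟨⟨BrWord.isStrictWeakOrder_pathLT, BrWord.wellFounded_pathLT⟩,
    BrAlg.isLeading_rbElement lam,
    fun q x y => BrAlg.isLeading_mapWords_rbElement (BrWord.isContext_subst q) lam x y,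
    BrAlg.isGroebnerShirshovBasis_rbSet lam, BrAlg.isFreeRotaBaxter_quotient_rbIdeal X lam,
    BrAlg.linearIndependent_rbIrr lam, BrAlg.span_rbIrr lam⟩
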